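/- There exists a universal constant $c>0$ such that the following holds. Let $n \ge 0$ be an integer, let $X=(X_1,\dots,X_n)$ be a Gaussian random vector (not necessarily centred, and possibly degenerate) with covariance $K(i,j)=\mathrm{Cov}[X_i,X_j]$, let $I_1,I_2\subseteq\{1,\dots,n\}$, and let $A_1,A_2\subseteq\mathbb{R}^n$ be Borel sets such that, for $k=1,2$, $A_k$ is increasing (if $x\in A_k$ and $v\in[0,\infty)^n$, then $x+v\in A_k$) and supported on $I_k$ (if $x,v\in\mathbb{R}^n$ and $v_i=0$ for all $i\in I_k$, then $x\in A_k$ if and only if $x+v\in A_k$). Write $\|K_{I_1,I_2}\|_\infty=\max_{i\in I_1,\,j\in I_2}|K(i,j)|$ (equal to $0$ if $I_1$ or $I_2$ is empty), and for $\varepsilon \in \mathbb{R}$ let $X\pm\varepsilon$ denote the vector $(X_i\pm\varepsilon)_{1\le i\le n}$. Then for every $\varepsilon>0$, \[ \mathbb{P}[X\in A_1\cap A_2]-\mathbb{P}[X+\varepsilon\in A_1]\,\mathbb{P}[X+\varepsilon\in A_2]\le\frac{c\,\|K_{I_1,I_2}\|_\infty}{\varepsilon^2}, \tag{1} \] and \[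 \mathbb{P}[X-\varepsilon\in A_1]\,\mathbb{P}[X-\varepsilon\in A_2]-\mathbb{P}[X\in A_1\cap A_2]\le\frac{c\,\|K_{I_1,I_2}\|_\infty}{\varepsilon^2}. \tag{2} \] If moreover $K(i,j)\ge 0$ for all $i\in I_1$ and $j\in I_2$, then (1) holds with $c=1$ and (2) holds with $c=0$. -/

import Mathlib

open MeasureTheory ProbabilityTheory

/-- The matrix `K_{I,J} = (Cov[X i, X j])` with rows in `I` and columns in `J`. -/
noncomputable def crossCov {Ω : Type*} [MeasurableSpace Ω] (P : Measure Ω) {n : ℕ}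
    (X : Ω → Fin n → ℝ) (I J : Finset (Fin n)) : Matrix I J ℝ :=
  fun i j => cov[fun ω => X ω i, fun ω => X ω j; P]

/-- The largest absolute value of an entry of a finite matrix (`0` for an empty matrix). -/
noncomputable def maxAbsEntry {ι κ : Type*} (K : Matrix ι κ ℝ) : ℝ :=
  ⨆ p : ι × κ, |K p.1 p.2|

/-- A set `A ⊆ ℝⁿ` is supported on the coordinate set `I` if adding a vector that vanishes
on `I` never changes membership in `A`. -/
def IsSupportedOn {n : ℕ} (A : Set (Fin n → ℝ)) (I : Finset (Fin n)) : Prop :=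
  ∀ x v : Fin n → ℝ, (∀ i ∈ I, v i = 0) → (x ∈ A ↔ x + v ∈ A)

/-- A set `A ⊆ ℝⁿ` is increasing if it is stable under adding nonnegative vectors. -/
def IsIncreasing {n : ℕ} (A : Set (Fin n → ℝ)) : Prop :=
  ∀ x v : Fin n → ℝ, 0 ≤ v → x ∈ A → x + v ∈ A

/-- Increasing sets are exactly the upper sets of `ℝⁿ`. -/
theorem isIncreasing_iff_isUpperSet {n : ℕ} (A : Set (Fin n → ℝ)) :
    IsIncreasing A ↔ IsUpperSet A := by
  constructor
  · intro h x y hxy hx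
    have := h x (y - x) (sub_nonneg.mpr hxy) hx
    rwa [add_sub_cancel] at this
  · intro h x v hv hx
    exact h (le_add_of_nonneg_right hv) hx

/-!
The constant is `c = 1`. The idea is to replace each increasing set by a Lipschitz soft indicator
and to bound the covariance of the two soft indicators by Gaussian interpolation.

For an increasing set `A`, let `F x = max (0, 1 - dist (x, A) / ε)`, the distance being the one of
the sup norm. Then `𝟙_A ≤ F`, and `F` vanishes off `{x | x + ε ∈ A}`, because a point at distance
less than `ε` from some `a ∈ A` lies above `a` once `ε` is added to its coordinates
(`exists_isSoftIndicator`). Hence, with `F`, `G` attached to `A₁`, `A₂`, the left side of the upper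
bound is at most `Cov (F X, G X)`; attaching them to the sets `A₁ + ε`, `A₂ + ε` instead, the left
side of the lower bound is at most `-Cov (F X, G X)`
(`IsSoftIndicator.real_sub_le_covariance`).

For `C¹` functions `F`, `G` and `U`, `V` independent copies of the centred vector `X`, set
`h θ = 𝔼 [F U * G (cos θ U + sin θ V)]`, so that `Cov (F X, G X) = h 0 - h (π / 2)`. The rotation
invariance of `(U, V)` and an integration by parts in `V` (`integral_mul_dual_eq`) give
`h' θ = -sin θ * ∑ i j, K i j * 𝔼 [∂ᵢF (cos θ U - sin θ V) * ∂ⱼG U]`.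
Since `F` and `G` are increasing, `ε⁻¹`-Lipschitz for the sup norm, and depend only on the
coordinates in `I₁` and `I₂`, we have `∂ᵢF ≥ 0`, `∂ᵢF = 0` for `i ∉ I₁`, and `∑ i, ∂ᵢF ≤ ε⁻¹`, and
likewise for `G`. The double sum therefore lies between `-‖K‖ / ε²` and `‖K‖ / ε²`, and is
nonnegative when the entries of `K` indexed by `I₁ × I₂` are; as `∫ sin = 1` over `[0, π / 2]`, the
same holds for the covariance (`IsSoftIndicator.mul_covariance_le`). Convolution with a bump
function preserves all the properties of a soft indicator
(`IsSoftIndicator.exists_contDiff_approx`), which removes the smoothness assumption.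
-/

open scoped NNReal

/-! ### Gaussian integration by parts -/

/-- Stein's identity for a centred real Gaussian measure, possibly degenerate. -/
theorem stein_gaussianReal (v : ℝ≥0) {f : ℝ → ℝ} {C D : ℝ} (hf : Differentiable ℝ f)
    (hC : ∀ x, |f x| ≤ C) (hD : ∀ x, |deriv f x| ≤ D) :
    ∫ x, x * f x ∂gaussianReal 0 v = v * ∫ x, deriv f x ∂gaussianReal 0 v := by
  rcases eq_or_ne v 0 with rfl | hv
  · simp
  have hv' : (v : ℝ) ≠ 0 := by exact_mod_cast hv
  have hp : ∀ x, HasDerivAt (gaussianPDFReal 0 v) (-(x / v) * gaussianPDFReal 0 v x) x := by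
    intro x
    have h1 : HasDerivAt (fun y : ℝ => -(y - 0) ^ 2 / (2 * v)) (-(x / v)) x := by
      have := (((hasDerivAt_id x).sub_const 0).pow 2).neg.div_const (2 * (v : ℝ))
      refine this.congr_deriv ?_
      simp
      field_simp
    refine ((h1.exp).const_mul (√(2 * Real.pi * v))⁻¹).congr_deriv ?_
    rw [gaussianPDFReal]
    ring
  have hpi := integrable_gaussianPDFReal 0 v
  have hxpi : Integrable (fun x => x * gaussianPDFReal 0 v x) := by
    have h : Integrable (fun x : ℝ => x) (gaussianReal 0 v) :=
      (IsGaussian.integrable_id : Integrable id (gaussianReal 0 v))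
    rw [gaussianReal_of_var_ne_zero _ hv, integrable_withDensity_iff (measurable_gaussianPDF 0 v)
      (by simp [gaussianPDF])] at h
    simpa [toReal_gaussianPDF] using h
  have hfm := hf.continuous.aestronglyMeasurable (μ := (volume : Measure ℝ))
  have key := integral_mul_deriv_eq_deriv_mul_of_integrable (u := f) (u' := deriv f)
    (v := gaussianPDFReal 0 v) (v' := fun x => -(x / v) * gaussianPDFReal 0 v x)
    (fun x _ => (hf x).hasDerivAt) (fun x _ => hp x)
    ((hxpi.const_mul (-(v : ℝ)⁻¹)).bdd_mul (c := C) hfm (.of_forall hC) |>.congr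
      (.of_forall fun x => by simp only [Pi.mul_apply]; ring))
    (hpi.bdd_mul (c := D) (measurable_deriv f).aestronglyMeasurable (.of_forall hD))
    (hpi.bdd_mul (c := C) hfm (.of_forall hC))
  rw [integral_gaussianReal_eq_integral_smul hv, integral_gaussianReal_eq_integral_smul hv]
  have e1 : ∫ x, gaussianPDFReal 0 v x • (x * f x)
      = -v * ∫ x, f x * (-(x / v) * gaussianPDFReal 0 v x) := by
    rw [← integral_const_mul]
    congr 1 with x
    simp only [smul_eq_mul]
    field_simp
  rw [e1, key]
  simp [smul_eq_mul, mul_comm]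

theorem integrable_dual_mul_dual {E : Type*} [NormedAddCommGroup E] [NormedSpace ℝ E]
    [MeasurableSpace E] [BorelSpace E] (μ : Measure E) [IsGaussian μ] (L M : StrongDual ℝ E) :
    Integrable (fun x => L x * M x) μ :=
  (IsGaussian.memLp_dual μ L 2 (by simp)).integrable_mul (IsGaussian.memLp_dual μ M 2 (by simp))

section Banach

variable {E : Type*} [NormedAddCommGroup E] [NormedSpace ℝ E] [CompleteSpace E]
  [SecondCountableTopology E] [MeasurableSpace E] [BorelSpace E]

theorem integrable_dual_smul (μ : Measure E) [IsGaussian μ] (L : StrongDual ℝ E) :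
    Integrable (fun x => L x • x) μ :=
  memLp_one_iff_integrable.1
    (MemLp.smul (p := 2) (q := 2) IsGaussian.memLp_two_id (IsGaussian.memLp_dual μ L 2 (by simp)))

/-- Gaussian integration by parts. The vector `∫ y, L y • y ∂μ` is the image of `L` under the
covariance operator of `μ`. The proof writes a point as `R x + L x • w`, where `R x` and `L x` are
uncorrelated, hence independent, and applies Stein's identity to the second summand. -/
theorem integral_mul_dual_eq (μ : Measure E) [IsGaussian μ] (hμ : μ[id] = 0)
    (L : StrongDual ℝ E) {f : E → ℝ} {C : ℝ} {D : ℝ≥0} (hf : ContDiff ℝ 1 f)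
    (hC : ∀ x, |f x| ≤ C) (hD : LipschitzWith D f) :
    ∫ x, f x * L x ∂μ = ∫ x, fderiv ℝ f x (∫ y, L y • y ∂μ) ∂μ := by
  have hd : Differentiable ℝ f := hf.differentiable (by simp)
  have hmean : ∀ M : StrongDual ℝ E, μ[M] = 0 := fun M => by
    rw [IsGaussian.integral_dual]
    simp only [id] at hμ
    rw [hμ, map_zero]
  set s : E := ∫ y, L y • y ∂μ with hs
  have hMs : ∀ M : StrongDual ℝ E, M s = ∫ y, L y * M y ∂μ := fun M => by
    rw [hs, ← ContinuousLinearMap.integral_comp_comm M (integrable_dual_smul μ L)]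
    simp
  have hcov : ∀ M N : StrongDual ℝ E, cov[M, N; μ] = ∫ y, M y * N y ∂μ := fun M N => by
    simp [covariance, hmean]
  set σ : ℝ≥0 := Var[L; μ].toNNReal with hσ
  have hvar : Var[L; μ] = ∫ y, L y * L y ∂μ := by
    rw [← hcov, covariance_self L.continuous.aemeasurable]
  have hlaw : μ.map L = gaussianReal 0 σ := by
    rw [IsGaussian.map_eq_gaussianReal, hmean]
  have hσv : (σ : ℝ) = L s := by
    rw [hMs, ← hvar, hσ, Real.coe_toNNReal _ (variance_nonneg _ _)]
  -- if `L` has variance zero it vanishes almost surely, and both sides are zero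
  rcases eq_or_ne σ 0 with h0 | h0
  · have hL0 : (fun x => L x) =ᵐ[μ] 0 := by
      have hz : ∫ y, L y * L y ∂μ = 0 := by rw [← hMs, ← hσv, h0]; rfl
      rw [integral_eq_zero_iff_of_nonneg (fun y => mul_self_nonneg _)
        (integrable_dual_mul_dual μ L L)] at hz
      filter_upwards [hz] with y hy
      simpa using hy
    have hs0 : s = 0 := by
      rw [hs]
      apply integral_eq_zero_of_ae
      filter_upwards [hL0] with y hy
      simp [hy]
    rw [hs0]
    simp only [map_zero, integral_zero]
    apply integral_eq_zero_of_ae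
    filter_upwards [hL0] with y hy
    simp [hy]
  have hσ0 : (σ : ℝ) ≠ 0 := by exact_mod_cast h0
  -- the residual of the linear regression of `x` on `L x`
  let R : E →L[ℝ] E := ContinuousLinearMap.id ℝ E - L.smulRight ((σ : ℝ)⁻¹ • s)
  have hR : ∀ x, R x = x - L x • ((σ : ℝ)⁻¹ • s) := fun x => rfl
  have hind : IndepFun L R μ := by
    have hG : HasGaussianLaw (fun x => (L x, R x)) μ :=
      (IsGaussian.hasGaussianLaw_id (μ := μ)).map_fun (L.prod R)
    refine hG.indepFun_of_covariance_strongDual fun M N => ?_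
    have e1 : (M ∘ L : E → ℝ) = fun x => M 1 * L x := by
      ext x
      have : M (L x • (1 : ℝ)) = L x • M 1 := map_smul _ _ _
      simpa [mul_comm] using this
    have e2 : (N ∘ R : E → ℝ) = (N.comp R) := rfl
    rw [e1, e2, covariance_const_mul_left, hcov]
    have : ∫ y, L y * (N.comp R) y ∂μ = (N.comp R) s := (hMs _).symm
    rw [this]
    simp [hR, ← hσv, hσ0]
  have hRm : Measurable R := R.continuous.measurable
  have hLm : Measurable L := L.continuous.measurable
  have hprod : μ.map (fun x => (L x, R x)) = (gaussianReal 0 σ).prod (μ.map R) := by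
    rw [(indepFun_iff_map_prod_eq_prod_map_map hLm.aemeasurable hRm.aemeasurable).1 hind, hlaw]
  have hrec : ∀ x, R x + L x • ((σ : ℝ)⁻¹ • s) = x := fun x => by rw [hR]; abel
  have : IsProbabilityMeasure (μ.map R) := Measure.isProbabilityMeasure_map hRm.aemeasurable
  let w : E := (σ : ℝ)⁻¹ • s
  have hcont : Continuous (fun p : ℝ × E => p.2 + p.1 • w) := by fun_prop
  have hLRm : Measurable (fun x => (L x, R x)) := hLm.prodMk hRm
  have hf' : Continuous (fderiv ℝ f) := hf.continuous_fderiv (by simp)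
  have hfb : ∀ x, ‖fderiv ℝ f x‖ ≤ D := fun x => norm_fderiv_le_of_lipschitz ℝ hD
  have hc1 : Continuous (fun p : ℝ × E => p.1 * f (p.2 + p.1 • w)) :=
    continuous_fst.mul (hf.continuous.comp hcont)
  have hc2 : Continuous (fun p : ℝ × E => fderiv ℝ f (p.2 + p.1 • w) s) :=
    (hf'.comp hcont).clm_apply continuous_const
  have I1 : ∫ x, f x * L x ∂μ
      = ∫ p, p.1 * f (p.2 + p.1 • w) ∂((gaussianReal 0 σ).prod (μ.map R)) := by
    rw [← hprod, integral_map hLRm.aemeasurable hc1.aestronglyMeasurable]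
    simp only [w, hrec, mul_comm]
  have I2 : ∫ x, fderiv ℝ f x s ∂μ
      = ∫ p, fderiv ℝ f (p.2 + p.1 • w) s ∂((gaussianReal 0 σ).prod (μ.map R)) := by
    rw [← hprod, integral_map hLRm.aemeasurable hc2.aestronglyMeasurable]
    simp only [w, hrec]
  have hid : Integrable (fun p : ℝ × E => p.1) ((gaussianReal 0 σ).prod (μ.map R)) :=
    (IsGaussian.integrable_id : Integrable id (gaussianReal 0 σ)).comp_fst _
  rw [I1, I2, integral_prod_symm, integral_prod_symm]
  · congr 1 with r
    have hder : ∀ t : ℝ, HasDerivAt (fun t : ℝ => f (r + t • w)) (fderiv ℝ f (r + t • w) w) t := by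
      intro t
      have h1 : HasDerivAt (fun t : ℝ => r + t • w) w t := by
        simpa using ((hasDerivAt_id t).smul_const w).const_add r
      exact ((hd (r + t • w)).hasFDerivAt).comp_hasDerivAt t h1
    have hst := stein_gaussianReal σ (f := fun t : ℝ => f (r + t • w)) (C := C) (D := D * ‖w‖)
      (fun t => (hder t).differentiableAt) (fun t => hC _) (fun t => by
        rw [(hder t).deriv]
        exact ((fderiv ℝ f (r + t • w)).le_opNorm w).trans
          (mul_le_mul_of_nonneg_right (hfb _) (norm_nonneg _)))
    rw [hst, ← integral_const_mul]
    congr 1 with t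
    rw [(hder t).deriv]
    simp only [w, map_smul, smul_eq_mul]
    field_simp
  · refine Integrable.of_bound hc2.aestronglyMeasurable
      (D * ‖s‖) (.of_forall fun p => ?_)
    exact (ContinuousLinearMap.le_opNorm _ s).trans
      (mul_le_mul_of_nonneg_right (hfb _) (norm_nonneg _))
  · exact hid.mul_bdd (c := C) (hf.continuous.comp hcont).aestronglyMeasurable
      (.of_forall fun p => hC _)

/-! ### Interpolation between `(U, U)` and `(U, V)` by rotation -/

theorem hasDerivAt_integral_mul_rotation (μ : Measure E) [IsGaussian μ]
    {F G : E → ℝ} {C C' : ℝ} {D : ℝ≥0} (hF : Continuous F) (hG : ContDiff ℝ 1 G)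
    (hFC : ∀ x, |F x| ≤ C) (hGC : ∀ x, |G x| ≤ C') (hGD : LipschitzWith D G) (θ : ℝ) :
    HasDerivAt (fun θ : ℝ => ∫ p : E × E, F p.1 * G (θ.cos • p.1 + θ.sin • p.2) ∂(μ.prod μ))
      (∫ p : E × E, F p.1 * fderiv ℝ G (θ.cos • p.1 + θ.sin • p.2)
        (-θ.sin • p.1 + θ.cos • p.2) ∂(μ.prod μ)) θ := by
  have hC0 : 0 ≤ C := (abs_nonneg _).trans (hFC 0)
  have hG' : Continuous (fderiv ℝ G) := hG.continuous_fderiv (by simp)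
  have hGb : ∀ x, ‖fderiv ℝ G x‖ ≤ D := fun x => norm_fderiv_le_of_lipschitz ℝ hGD
  have hd : Differentiable ℝ G := hG.differentiable (by simp)
  have hGc := hG.continuous
  have hni : Integrable (fun x : E => ‖x‖) μ :=
    (IsGaussian.integrable_id : Integrable id μ).norm
  have hm : ∀ θ : ℝ, Continuous
      (fun p : E × E => F p.1 * G (θ.cos • p.1 + θ.sin • p.2)) := fun θ => by fun_prop
  refine (hasDerivAt_integral_of_dominated_loc_of_deriv_le
    (F := fun θ (p : E × E) => F p.1 * G (Real.cos θ • p.1 + Real.sin θ • p.2))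
    (F' := fun θ (p : E × E) => F p.1 * fderiv ℝ G (Real.cos θ • p.1 + Real.sin θ • p.2)
        (-Real.sin θ • p.1 + Real.cos θ • p.2))
    (bound := fun p : E × E => C * (D * (‖p.1‖ + ‖p.2‖))) Filter.univ_mem
    (.of_forall fun θ => (hm θ).aestronglyMeasurable)
    (.of_bound (hm θ).aestronglyMeasurable (C * C') (.of_forall fun p => ?_))
    ?_ (.of_forall fun p t _ => ?_) ?_ (.of_forall fun p t _ => ?_)).2
  · rw [norm_mul]
    exact mul_le_mul (hFC _) (hGC _) (norm_nonneg _) hC0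
  · apply Continuous.aestronglyMeasurable
    exact (hF.comp continuous_fst).mul ((hG'.comp (by fun_prop)).clm_apply (by fun_prop))
  · rw [norm_mul]
    refine mul_le_mul (hFC _) ((ContinuousLinearMap.le_opNorm _ _).trans
      (mul_le_mul (hGb _) ((norm_add_le _ _).trans (add_le_add ?_ ?_)) (norm_nonneg _)
        D.coe_nonneg)) (norm_nonneg _) hC0
    · rw [norm_smul, norm_neg]
      exact mul_le_of_le_one_left (norm_nonneg _) (Real.abs_sin_le_one t)
    · rw [norm_smul]
      exact mul_le_of_le_one_left (norm_nonneg _) (Real.abs_cos_le_one t)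
  · exact (((hni.comp_fst μ).add (hni.comp_snd μ)).const_mul _).const_mul _
  · have h1 : HasDerivAt (fun t : ℝ => Real.cos t • p.1 + Real.sin t • p.2)
        (-Real.sin t • p.1 + Real.cos t • p.2) t :=
      ((Real.hasDerivAt_cos t).smul_const _).add ((Real.hasDerivAt_sin t).smul_const _)
    exact (((hd _).hasFDerivAt).comp_hasDerivAt t h1).const_mul (F p.1)

/-- The derivative of the interpolation is at least `-sin θ * b`, by rotating `(U, V)` and
integrating by parts in the second variable. -/
theorem integral_mul_rotation_deriv_ge (μ : Measure E) [IsGaussian μ] (hμ : μ[id] = 0)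
    {F G : E → ℝ} {C : ℝ} {D D' : ℝ≥0} {b : ℝ} (hF : ContDiff ℝ 1 F) (hG : ContDiff ℝ 1 G)
    (hFC : ∀ x, |F x| ≤ C) (hFD : LipschitzWith D F) (hGD : LipschitzWith D' G)
    (hb : ∀ u w, ∫ x, fderiv ℝ F u x * fderiv ℝ G w x ∂μ ≤ b) {θ : ℝ} (hθ : 0 ≤ θ.sin) :
    -θ.sin * b ≤ ∫ p : E × E, F p.1 * fderiv ℝ G (θ.cos • p.1 + θ.sin • p.2)
        (-θ.sin • p.1 + θ.cos • p.2) ∂(μ.prod μ) := by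
  have hG' : Continuous (fderiv ℝ G) := hG.continuous_fderiv (by simp)
  have hF' : Continuous (fderiv ℝ F) := hF.continuous_fderiv (by simp)
  have hGb : ∀ x, ‖fderiv ℝ G x‖ ≤ D' := fun x => norm_fderiv_le_of_lipschitz ℝ hGD
  have hFb : ∀ x, ‖fderiv ℝ F x‖ ≤ D := fun x => norm_fderiv_le_of_lipschitz ℝ hFD
  have hFd : Differentiable ℝ F := hF.differentiable (by simp)
  have hni : Integrable (fun x : E => ‖x‖) μ :=
    (IsGaussian.integrable_id : Integrable id μ).norm
  -- the integrand expressed in the rotated variables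
  let Ψ : E × E → ℝ := fun q => F (θ.cos • q.1 - θ.sin • q.2) * fderiv ℝ G q.1 q.2
  have hΨc : Continuous Ψ := (hF.continuous.comp (by fun_prop)).mul
    ((hG'.comp continuous_fst).clm_apply continuous_snd)
  have hΨi : Integrable Ψ (μ.prod μ) := by
    refine Integrable.bdd_mul (c := C) (Integrable.mono' ((hni.comp_snd μ).const_mul (D' : ℝ))
      ((hG'.comp continuous_fst).clm_apply continuous_snd).aestronglyMeasurable
      (.of_forall fun q => (ContinuousLinearMap.le_opNorm _ _).trans
        (mul_le_mul_of_nonneg_right (hGb _) (norm_nonneg _))))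
      (hF.continuous.comp (by fun_prop)).aestronglyMeasurable (.of_forall fun q => hFC _)
  have e : ∫ p : E × E, F p.1 * fderiv ℝ G (θ.cos • p.1 + θ.sin • p.2)
        (-θ.sin • p.1 + θ.cos • p.2) ∂(μ.prod μ) = ∫ q, Ψ q ∂(μ.prod μ) := by
    conv_rhs => rw [← IsGaussian.map_rotation_eq_self hμ θ]
    rw [integral_map (ContinuousLinearMap.continuous _).aemeasurable hΨc.aestronglyMeasurable]
    congr 1 with p
    simp only [Ψ, ContinuousLinearMap.rotation_apply]
    congr 2
    have : θ.cos • (θ.cos • p.1 + θ.sin • p.2) - θ.sin • (-θ.sin • p.1 + θ.cos • p.2)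
        = (θ.sin ^ 2 + θ.cos ^ 2) • p.1 := by module
    rw [this, Real.sin_sq_add_cos_sq, one_smul]
  rw [e, integral_prod _ hΨi]
  have hconst : ∫ _u : E, -θ.sin * b ∂μ = -θ.sin * b := by simp
  rw [← hconst]
  refine integral_mono (integrable_const _) hΨi.integral_prod_left fun u => ?_
  have hlin : ∀ v : E, HasFDerivAt (fun v : E => F (θ.cos • u - θ.sin • v))
      (-θ.sin • fderiv ℝ F (θ.cos • u - θ.sin • v)) v := fun v => by
    have h1 : HasFDerivAt (fun v : E => θ.cos • u - θ.sin • v)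
        (-(θ.sin • ContinuousLinearMap.id ℝ E)) v :=
      ((hasFDerivAt_id v).const_smul θ.sin).const_sub _
    refine ((hFd _).hasFDerivAt.comp v h1).congr_fderiv ?_
    ext x
    simp
  have hcd : ContDiff ℝ 1 (fun v : E => F (θ.cos • u - θ.sin • v)) := hF.comp (by fun_prop)
  have hlip : LipschitzWith D (fun v : E => F (θ.cos • u - θ.sin • v)) := by
    refine LipschitzWith.of_dist_le_mul fun v w => (hFD.dist_le_mul _ _).trans ?_
    refine mul_le_mul_of_nonneg_left ?_ D.coe_nonneg
    rw [dist_sub_left, dist_smul₀]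
    exact mul_le_of_le_one_left dist_nonneg (Real.abs_sin_le_one θ)
  have hibp := integral_mul_dual_eq μ hμ (fderiv ℝ G u) hcd (fun v => hFC _) hlip
  simp only [Ψ]
  rw [hibp, ← hconst]
  have hval : ∀ v, fderiv ℝ (fun v : E => F (θ.cos • u - θ.sin • v)) v
      (∫ y, fderiv ℝ G u y • y ∂μ)
      = -θ.sin * ∫ x, fderiv ℝ F (θ.cos • u - θ.sin • v) x * fderiv ℝ G u x ∂μ := fun v => by
    rw [(hlin v).fderiv, smul_apply, smul_eq_mul,
      ← ContinuousLinearMap.integral_comp_comm _ (integrable_dual_smul μ _)]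
    simp [mul_comm]
  refine integral_mono (integrable_const _) ?_ fun v => ?_
  · refine Integrable.of_bound ((hcd.continuous_fderiv (by simp)).clm_apply
      continuous_const).aestronglyMeasurable (D * ‖∫ y, fderiv ℝ G u y • y ∂μ‖)
      (.of_forall fun v => (ContinuousLinearMap.le_opNorm _ _).trans
        (mul_le_mul_of_nonneg_right (norm_fderiv_le_of_lipschitz ℝ hlip) (norm_nonneg _)))
  · simp only [hval]
    exact mul_le_mul_of_nonpos_left (hb _ _) (neg_nonpos.2 hθ)

/-- The covariance of `F` and `G` is at most `b` as soon as the derivatives of `F` and `G`, paired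
by the covariance form of `μ`, give at most `b` at any two points. -/
theorem integral_mul_sub_le_of_contDiff (μ : Measure E) [IsGaussian μ] (hμ : μ[id] = 0)
    {F G : E → ℝ} {C C' : ℝ} {D D' : ℝ≥0} {b : ℝ} (hF : ContDiff ℝ 1 F) (hG : ContDiff ℝ 1 G)
    (hFC : ∀ x, |F x| ≤ C) (hGC : ∀ x, |G x| ≤ C')
    (hFD : LipschitzWith D F) (hGD : LipschitzWith D' G)
    (hb : ∀ u w, ∫ x, fderiv ℝ F u x * fderiv ℝ G w x ∂μ ≤ b) :
    ∫ x, F x * G x ∂μ - (∫ x, F x ∂μ) * ∫ x, G x ∂μ ≤ b := by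
  have hder := hasDerivAt_integral_mul_rotation μ hF.continuous hG hFC hGC hGD
  set h : ℝ → ℝ := fun θ => ∫ p : E × E, F p.1 * G (θ.cos • p.1 + θ.sin • p.2) ∂(μ.prod μ)
  have hmono : MonotoneOn (fun θ => h θ - b * θ.cos) (Set.Icc 0 (Real.pi / 2)) := by
    have hd : ∀ θ, HasDerivAt (fun θ => h θ - b * θ.cos) _ θ :=
      fun θ => (hder θ).sub ((Real.hasDerivAt_cos θ).const_mul b)
    refine monotoneOn_of_deriv_nonneg (convex_Icc _ _)
      (fun θ _ => (hd θ).continuousAt.continuousWithinAt)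
      (fun θ _ => (hd θ).differentiableAt.differentiableWithinAt) fun θ hθ => ?_
    rw [interior_Icc] at hθ
    rw [(hd θ).deriv]
    have hs : 0 ≤ θ.sin :=
      Real.sin_nonneg_of_nonneg_of_le_pi hθ.1.le (by linarith [hθ.2, Real.pi_pos])
    linarith [integral_mul_rotation_deriv_ge μ hμ hF hG hFC hFD hGD hb hs]
  have h0 : h 0 = ∫ x, F x * G x ∂μ := by
    simp only [h, Real.cos_zero, Real.sin_zero, one_smul, zero_smul, add_zero]
    rw [integral_fun_fst (μ := μ) (ν := μ) (fun x => F x * G x)]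
    simp
  have h1 : h (Real.pi / 2) = (∫ x, F x ∂μ) * ∫ x, G x ∂μ := by
    simp only [h, Real.cos_pi_div_two, Real.sin_pi_div_two, one_smul, zero_smul, zero_add]
    exact integral_prod_mul F G
  have hp := Real.pi_pos.le
  have := hmono (a := 0) (b := Real.pi / 2) ⟨le_rfl, by positivity⟩ ⟨by positivity, le_rfl⟩
    (by positivity)
  simp only [h0, h1, Real.cos_zero, Real.cos_pi_div_two, mul_zero, mul_one, sub_zero] at this
  linarith

end Banach

/-! ### Soft indicators of increasing sets -/

/-- `F` is a soft indicator with support `I` and slope `L`: an increasing function with values in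
`[0, 1]`, depending only on the coordinates in `I`, and `L`-Lipschitz for the sup norm (which is the
norm of `Fin n → ℝ`). -/
structure IsSoftIndicator {n : ℕ} (F : (Fin n → ℝ) → ℝ) (I : Finset (Fin n)) (L : ℝ≥0) :
    Prop where
  mono : Monotone F
  lip : LipschitzWith L F
  supp : ∀ x v : Fin n → ℝ, (∀ i ∈ I, v i = 0) → F (x + v) = F x
  nonneg : ∀ x, 0 ≤ F x
  le_one : ∀ x, F x ≤ 1

namespace IsSoftIndicator

variable {n : ℕ} {F G : (Fin n → ℝ) → ℝ} {I J : Finset (Fin n)} {L M : ℝ≥0}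

theorem abs_le_one (hF : IsSoftIndicator F I L) (x : Fin n → ℝ) : |F x| ≤ 1 := by
  rw [abs_of_nonneg (hF.nonneg x)]
  exact hF.le_one x

theorem integrable (hF : IsSoftIndicator F I L) (μ : Measure (Fin n → ℝ)) [IsFiniteMeasure μ] :
    Integrable F μ :=
  .of_bound hF.lip.continuous.aestronglyMeasurable 1 (.of_forall hF.abs_le_one)

theorem integrable_mul (hF : IsSoftIndicator F I L) (hG : IsSoftIndicator G J M)
    (μ : Measure (Fin n → ℝ)) [IsFiniteMeasure μ] : Integrable (fun x => F x * G x) μ :=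
  (hG.integrable μ).bdd_mul (c := 1) hF.lip.continuous.aestronglyMeasurable
    (.of_forall hF.abs_le_one)

theorem comp_add_right (hF : IsSoftIndicator F I L) (m : Fin n → ℝ) :
    IsSoftIndicator (fun x => F (x + m)) I L where
  mono _ _ h := hF.mono (add_le_add_left h m)
  lip := LipschitzWith.of_dist_le_mul fun x y => by
    simpa using hF.lip.dist_le_mul (x + m) (y + m)
  supp x v hv := by rw [add_right_comm, hF.supp _ v hv]
  nonneg _ := hF.nonneg _
  le_one _ := hF.le_one _

/-- Smoothing by convolution with a bump function keeps a soft indicator a soft indicator, with the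
same support and slope. -/
theorem exists_contDiff_approx (hF : IsSoftIndicator F I L) {δ : ℝ} (hδ : 0 < δ) :
    ∃ G, IsSoftIndicator G I L ∧ ContDiff ℝ 1 G ∧ ∀ x, |G x - F x| ≤ δ := by
  have hr : 0 < δ / (L + 1) := by positivity
  let φ : ContDiffBump (0 : Fin n → ℝ) := ⟨δ / (L + 1) / 2, δ / (L + 1), by positivity, by linarith⟩
  let k : (Fin n → ℝ) → ℝ := φ.normed volume
  have hk0 : ∀ t, 0 ≤ k t := fun t => φ.nonneg_normed t
  have hk1 : ∫ t, k t = 1 := φ.integral_normed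
  have hFc := hF.lip.continuous
  have hki : Integrable k := φ.integrable_normed
  have hi : ∀ x, Integrable (fun t => k t * F (x - t)) := fun x =>
    hki.mul_bdd (c := 1) (by fun_prop) (.of_forall fun t => hF.abs_le_one _)
  have hcs : HasCompactSupport k := φ.hasCompactSupport_normed
  have hGsm : ContDiff ℝ 1 (convolution k F (ContinuousLinearMap.lsmul ℝ ℝ) volume) :=
    hcs.contDiff_convolution_left _ φ.contDiff_normed hFc.locallyIntegrable
  have hG : ∀ x, convolution k F (ContinuousLinearMap.lsmul ℝ ℝ) volume x
      = ∫ t, k t * F (x - t) := fun x => rfl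
  refine ⟨_, ⟨fun x y hxy => ?_, .of_dist_le_mul fun x y => ?_, fun x v hv => ?_, fun x => ?_,
    fun x => ?_⟩, hGsm, fun x => ?_⟩
  · rw [hG, hG]
    exact integral_mono (hi x) (hi y) fun t =>
      mul_le_mul_of_nonneg_left (hF.mono (sub_le_sub_right hxy t)) (hk0 t)
  · rw [hG, hG, dist_eq_norm, ← integral_sub (hi x) (hi y)]
    refine (norm_integral_le_of_norm_le (hki.mul_const (L * dist x y)) (.of_forall fun t => ?_)).trans
      (by rw [integral_mul_const, hk1, one_mul])
    rw [← mul_sub, norm_mul, Real.norm_of_nonneg (hk0 t), ← dist_eq_norm]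
    exact mul_le_mul_of_nonneg_left (by simpa using hF.lip.dist_le_mul (x - t) (y - t)) (hk0 t)
  · rw [hG, hG]
    congr 1 with t
    rw [add_sub_right_comm, hF.supp _ v hv]
  · rw [hG]
    exact integral_nonneg fun t => mul_nonneg (hk0 t) (hF.nonneg _)
  · rw [hG, ← hk1]
    exact integral_mono (hi x) hki fun t => mul_le_of_le_one_right (hk0 t) (hF.le_one _)
  · refine φ.dist_normed_convolution_le hFc.aestronglyMeasurable fun y hy => ?_
    refine (hF.lip.dist_le_mul y x).trans ?_
    have hy' : dist y x ≤ δ / (L + 1) := (Metric.mem_ball.1 hy).le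
    calc L * dist y x ≤ (L + 1) * (δ / (L + 1)) := by gcongr; linarith
      _ = δ := by field_simp

theorem fderiv_single_nonneg (hF : IsSoftIndicator F I L) (hd : Differentiable ℝ F)
    (x : Fin n → ℝ) (i : Fin n) : 0 ≤ fderiv ℝ F x (Pi.single i 1) := by
  have hmono : Monotone (fun t : ℝ => F (x + t • Pi.single i 1)) := fun s t hst =>
    hF.mono (add_le_add_right (smul_le_smul_of_nonneg_right hst
      (Pi.single_nonneg.2 zero_le_one)) x)
  have h := ((hd x).hasFDerivAt.hasLineDerivAt (Pi.single i (1 : ℝ))).deriv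
  rw [← h]
  exact hmono.deriv_nonneg

theorem fderiv_single_eq_zero (hF : IsSoftIndicator F I L) (hd : Differentiable ℝ F)
    (x : Fin n → ℝ) {i : Fin n} (hi : i ∉ I) : fderiv ℝ F x (Pi.single i 1) = 0 := by
  have h := ((hd x).hasFDerivAt.hasLineDerivAt (Pi.single i (1 : ℝ))).deriv
  rw [← h]
  have : (fun t : ℝ => F (x + t • Pi.single i 1)) = fun _ => F x := by
    ext t
    refine hF.supp x _ fun j hj => ?_
    have : j ≠ i := fun h => hi (h ▸ hj)
    simp [this]
  rw [this, deriv_const]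

/-- The sum of the partial derivatives is the derivative in the direction `(1, …, 1)`, a vector of
sup norm at most `1`. -/
theorem sum_fderiv_single_le (hF : IsSoftIndicator F I L) (x : Fin n → ℝ) :
    ∑ i, fderiv ℝ F x (Pi.single i 1) ≤ L := by
  rw [← map_sum, Finset.univ_sum_single (fun _ : Fin n => (1 : ℝ))]
  refine (le_abs_self _).trans (((fderiv ℝ F x).le_opNorm _).trans ?_)
  calc ‖fderiv ℝ F x‖ * ‖fun _ : Fin n => (1 : ℝ)‖ ≤ L * 1 := by
        refine mul_le_mul (norm_fderiv_le_of_lipschitz ℝ hF.lip) ?_ (norm_nonneg _) L.coe_nonneg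
        simpa using pi_norm_const_le (ι := Fin n) (1 : ℝ)
    _ = L := mul_one _

theorem sum_fderiv_mul_le (hF : IsSoftIndicator F I L) (hG : IsSoftIndicator G J M)
    (hFd : Differentiable ℝ F) (hGd : Differentiable ℝ G) {k : Fin n → Fin n → ℝ} {κ : ℝ}
    (hκ : 0 ≤ κ) (hk : ∀ i ∈ I, ∀ j ∈ J, k i j ≤ κ) (u w : Fin n → ℝ) :
    ∑ i, ∑ j, fderiv ℝ F u (Pi.single i 1) * fderiv ℝ G w (Pi.single j 1) * k i j
      ≤ L * M * κ := by
  have h0 := hF.fderiv_single_nonneg hFd u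
  have h0' := hG.fderiv_single_nonneg hGd w
  calc _ ≤ ∑ i, ∑ j, fderiv ℝ F u (Pi.single i 1) * fderiv ℝ G w (Pi.single j 1) * κ := by
        refine Finset.sum_le_sum fun i _ => Finset.sum_le_sum fun j _ => ?_
        by_cases hi : i ∈ I
        · by_cases hj : j ∈ J
          · exact mul_le_mul_of_nonneg_left (hk i hi j hj) (mul_nonneg (h0 i) (h0' j))
          · simp [hG.fderiv_single_eq_zero hGd w hj]
        · simp [hF.fderiv_single_eq_zero hFd u hi]
    _ = (∑ i, fderiv ℝ F u (Pi.single i 1)) * (∑ j, fderiv ℝ G w (Pi.single j 1)) * κ := by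
        simp_rw [Finset.sum_mul_sum, Finset.sum_mul]
    _ ≤ L * M * κ := by
        refine mul_le_mul_of_nonneg_right (mul_le_mul (hF.sum_fderiv_single_le u)
          (hG.sum_fderiv_single_le w) (Finset.sum_nonneg fun j _ => h0' j) L.coe_nonneg) hκ

end IsSoftIndicator

theorem integral_dual_mul_dual_eq_sum {n : ℕ} (μ : Measure (Fin n → ℝ)) [IsGaussian μ]
    (A B : StrongDual ℝ (Fin n → ℝ)) :
    ∫ x, A x * B x ∂μ
      = ∑ i, ∑ j, A (Pi.single i 1) * B (Pi.single j 1) * ∫ x, x i * x j ∂μ := by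
  have hA : ∀ (A : StrongDual ℝ (Fin n → ℝ)) x, A x = ∑ i, A (Pi.single i 1) * x i := by
    intro A x
    conv_lhs => rw [← Finset.univ_sum_single x, map_sum]
    refine Finset.sum_congr rfl fun i _ => ?_
    have : Pi.single i (x i) = x i • (Pi.single i 1 : Fin n → ℝ) := by
      rw [← Pi.single_smul', smul_eq_mul, mul_one]
    rw [this, map_smul, smul_eq_mul, mul_comm]
  have hij : ∀ i j, Integrable (fun x : Fin n → ℝ => x i * x j) μ := fun i j =>
    integrable_dual_mul_dual μ (ContinuousLinearMap.proj i) (ContinuousLinearMap.proj j)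
  have e : ∀ x, A x * B x
      = ∑ i, ∑ j, A (Pi.single i 1) * B (Pi.single j 1) * (x i * x j) := fun x => by
    rw [hA A, hA B, Finset.sum_mul_sum]
    exact Finset.sum_congr rfl fun i _ => Finset.sum_congr rfl fun j _ => by ring
  simp_rw [e]
  rw [integral_finsetSum _ fun i _ => integrable_finsetSum _ fun j _ => (hij i j).const_mul _]
  refine Finset.sum_congr rfl fun i _ => ?_
  rw [integral_finsetSum _ fun j _ => (hij i j).const_mul _]
  exact Finset.sum_congr rfl fun j _ => integral_const_mul _ _

/-! ### Covariance of soft indicators of a Gaussian vector -/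

namespace IsSoftIndicator

variable {n : ℕ} {F G : (Fin n → ℝ) → ℝ} {I J : Finset (Fin n)} {L M : ℝ≥0}

theorem mul_covariance_le_of_contDiff (hF : IsSoftIndicator F I L) (hG : IsSoftIndicator G J M)
    (hFs : ContDiff ℝ 1 F) (hGs : ContDiff ℝ 1 G) (μ : Measure (Fin n → ℝ)) [IsGaussian μ]
    (hμ : μ[id] = 0) {s κ : ℝ} (hκ : 0 ≤ κ)
    (hk : ∀ i ∈ I, ∀ j ∈ J, s * ∫ x, x i * x j ∂μ ≤ κ) :
    s * (∫ x, F x * G x ∂μ - (∫ x, F x ∂μ) * ∫ x, G x ∂μ) ≤ L * M * κ := by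
  have hFd : Differentiable ℝ F := hFs.differentiable (by simp)
  have hGd : Differentiable ℝ G := hGs.differentiable (by simp)
  have hlip : LipschitzWith (‖s‖₊ * L) (fun x => s * F x) := .of_dist_le_mul fun x y => by
    rw [dist_eq_norm, ← mul_sub, norm_mul, NNReal.coe_mul, coe_nnnorm, mul_assoc, ← dist_eq_norm]
    exact mul_le_mul_of_nonneg_left (hF.lip.dist_le_mul x y) (norm_nonneg s)
  have key := integral_mul_sub_le_of_contDiff μ hμ (F := fun x => s * F x) (C := |s|) (C' := 1)
    (b := L * M * κ) (contDiff_const.mul hFs) hGs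
    (fun x => by rw [abs_mul]; exact mul_le_of_le_one_right (abs_nonneg s) (hF.abs_le_one x))
    hG.abs_le_one hlip hG.lip fun u w => by
      have hds : fderiv ℝ (fun x => s * F x) u = s • fderiv ℝ F u :=
        fderiv_const_mul (hFd u) s
      rw [hds, integral_dual_mul_dual_eq_sum]
      refine le_of_eq_of_le (Finset.sum_congr rfl fun i _ => Finset.sum_congr rfl fun j _ => ?_)
        (hF.sum_fderiv_mul_le hG hFd hGd hκ hk u w)
      rw [smul_apply, smul_eq_mul]
      ring
  refine le_of_eq_of_le ?_ key
  simp_rw [mul_assoc]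
  rw [integral_const_mul, integral_const_mul]
  ring

theorem mul_covariance_le_of_centered (hF : IsSoftIndicator F I L) (hG : IsSoftIndicator G J M)
    (μ : Measure (Fin n → ℝ)) [IsGaussian μ] (hμ : μ[id] = 0) {s κ : ℝ} (hκ : 0 ≤ κ)
    (hk : ∀ i ∈ I, ∀ j ∈ J, s * ∫ x, x i * x j ∂μ ≤ κ) :
    s * (∫ x, F x * G x ∂μ - (∫ x, F x ∂μ) * ∫ x, G x ∂μ) ≤ L * M * κ := by
  -- replacing `F`, `G` by smooth soft indicators at distance `δ` costs at most `4 * δ`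
  have hprod : ∀ {a b a' b' δ : ℝ}, |a| ≤ 1 → |b'| ≤ 1 → |a' - a| ≤ δ → |b' - b| ≤ δ →
      |a' * b' - a * b| ≤ 2 * δ := by
    intro a b a' b' δ ha hb' haa hbb
    calc |a' * b' - a * b| = |(a' - a) * b' + a * (b' - b)| := by ring_nf
      _ ≤ |a' - a| * |b'| + |a| * |b' - b| := by
        rw [← abs_mul, ← abs_mul]; exact abs_add_le _ _
      _ ≤ δ * 1 + 1 * δ := by
        have := (abs_nonneg _).trans haa
        gcongr
      _ = 2 * δ := by ring
  have hdiff : ∀ {f g : (Fin n → ℝ) → ℝ} {C : ℝ}, Integrable f μ → Integrable g μ →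
      (∀ x, |f x - g x| ≤ C) → |∫ x, f x ∂μ - ∫ x, g x ∂μ| ≤ C := by
    intro f g C hf hg h
    rw [← integral_sub hf hg]
    simpa using norm_integral_le_of_norm_le_const (μ := μ) (f := fun x => f x - g x)
      (.of_forall h)
  have hint : ∀ {f : (Fin n → ℝ) → ℝ}, (∀ x, |f x| ≤ 1) → |∫ x, f x ∂μ| ≤ 1 := by
    intro f h
    simpa using norm_integral_le_of_norm_le_const (μ := μ) (f := f) (.of_forall h)
  refine le_of_forall_pos_le_add fun η hη => ?_
  obtain ⟨δ, hδ, hδη⟩ : ∃ δ > 0, |s| * (4 * δ) ≤ η := by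
    refine ⟨η / (4 * (|s| + 1)), by positivity, ?_⟩
    have : |s| * (4 * (η / (4 * (|s| + 1)))) = η * (|s| / (|s| + 1)) := by field_simp
    rw [this]
    exact mul_le_of_le_one_right hη.le ((div_le_one (by positivity)).2 (by linarith))
  obtain ⟨F', hF', hFs, hFF⟩ := hF.exists_contDiff_approx hδ
  obtain ⟨G', hG', hGs, hGG⟩ := hG.exists_contDiff_approx hδ
  have h0 := hF'.mul_covariance_le_of_contDiff hG' hFs hGs μ hμ hκ hk
  have h1 := hdiff (hF'.integrable_mul hG' μ) (hF.integrable_mul hG μ)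
    fun x => hprod (hF.abs_le_one x) (hG'.abs_le_one x) (hFF x) (hGG x)
  have h2 := hprod (hint hF.abs_le_one) (hint hG'.abs_le_one)
    (hdiff (hF'.integrable μ) (hF.integrable μ) hFF)
    (hdiff (hG'.integrable μ) (hG.integrable μ) hGG)
  have h3 : |s * ((∫ x, F' x * G' x ∂μ - (∫ x, F' x ∂μ) * ∫ x, G' x ∂μ)
      - (∫ x, F x * G x ∂μ - (∫ x, F x ∂μ) * ∫ x, G x ∂μ))| ≤ |s| * (4 * δ) := by
    rw [abs_mul]
    refine mul_le_mul_of_nonneg_left ?_ (abs_nonneg s)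
    rw [abs_le] at h1 h2 ⊢
    constructor <;> linarith [h1.1, h1.2, h2.1, h2.2]
  have h4 := (abs_le.1 h3).1
  rw [mul_sub] at h4
  linarith

/-- Upper bounds on the covariance of two soft indicators come from `s = 1`, lower bounds from
`s = -1`. -/
theorem mul_covariance_le (hF : IsSoftIndicator F I L) (hG : IsSoftIndicator G J M)
    (μ : Measure (Fin n → ℝ)) [IsGaussian μ] {s κ : ℝ} (hκ : 0 ≤ κ)
    (hk : ∀ i ∈ I, ∀ j ∈ J, s * cov[fun x => x i, fun x => x j; μ] ≤ κ) :
    s * (∫ x, F x * G x ∂μ - (∫ x, F x ∂μ) * ∫ x, G x ∂μ) ≤ L * M * κ := by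
  set m : Fin n → ℝ := ∫ x, x ∂μ with hm
  have hmi : ∀ i, m i = ∫ x, x i ∂μ := fun i =>
    (IsGaussian.integral_dual (μ := μ) (ContinuousLinearMap.proj i)).symm
  have hmeas : Measurable (fun x : Fin n → ℝ => x - m) := by fun_prop
  have hmap : ∀ f : (Fin n → ℝ) → ℝ, Continuous f →
      ∫ x, f x ∂(μ.map fun x => x - m) = ∫ x, f (x - m) ∂μ := fun f hf =>
    integral_map hmeas.aemeasurable hf.aestronglyMeasurable
  have h0 : (μ.map fun x => x - m)[id] = 0 := by
    rw [integral_map hmeas.aemeasurable continuous_id.aestronglyMeasurable]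
    have hid : Integrable (fun x => x) μ := IsGaussian.integrable_id
    simp only [id]
    rw [integral_sub hid (integrable_const m)]
    simp [hm]
  have key := (hF.comp_add_right m).mul_covariance_le_of_centered (hG.comp_add_right m)
    (μ.map fun x => x - m) h0 (s := s) hκ fun i hi j hj => by
      rw [hmap _ (by fun_prop)]
      simpa only [covariance, ← hmi, Pi.sub_apply] using hk i hi j hj
  have hFc := hF.lip.continuous
  have hGc := hG.lip.continuous
  rw [hmap _ (by fun_prop), hmap _ (by fun_prop), hmap _ (by fun_prop)] at key
  simpa only [sub_add_cancel] using key

/-- If `𝟙_B₁ ≤ F ≤ 𝟙_C₁` and `𝟙_B₂ ≤ G ≤ 𝟙_C₂`, then the covariance of `F` and `G` controls the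
failure of independence up to passing from `B₁`, `B₂` to `C₁`, `C₂`. -/
theorem real_sub_le_covariance (hF : IsSoftIndicator F I L) (hG : IsSoftIndicator G J M)
    (μ : Measure (Fin n → ℝ)) [IsProbabilityMeasure μ] {B₁ B₂ C₁ C₂ : Set (Fin n → ℝ)}
    (hB₁ : MeasurableSet B₁) (hB₂ : MeasurableSet B₂) (hC₁ : MeasurableSet C₁)
    (hC₂ : MeasurableSet C₂) (hFB : ∀ x ∈ B₁, F x = 1) (hGB : ∀ x ∈ B₂, G x = 1)
    (hFC : ∀ x ∉ C₁, F x = 0) (hGC : ∀ x ∉ C₂, G x = 0) :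
    μ.real (B₁ ∩ B₂) - μ.real C₁ * μ.real C₂
        ≤ ∫ x, F x * G x ∂μ - (∫ x, F x ∂μ) * ∫ x, G x ∂μ ∧
      μ.real B₁ * μ.real B₂ - μ.real (C₁ ∩ C₂)
        ≤ -(∫ x, F x * G x ∂μ - (∫ x, F x ∂μ) * ∫ x, G x ∂μ) := by
  have hlow : ∀ {B : Set (Fin n → ℝ)} {f : (Fin n → ℝ) → ℝ}, MeasurableSet B →
      Integrable f μ → (∀ x, 0 ≤ f x) → (∀ x ∈ B, f x = 1) → μ.real B ≤ ∫ x, f x ∂μ := by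
    intro B f hB hf h0 h1
    rw [← integral_indicator_one hB]
    refine integral_mono ((integrable_const 1).indicator hB) hf fun x => ?_
    by_cases hx : x ∈ B
    · simp [hx, h1 x hx]
    · simpa [hx] using h0 x
  have hup : ∀ {C : Set (Fin n → ℝ)} {f : (Fin n → ℝ) → ℝ}, MeasurableSet C →
      Integrable f μ → (∀ x, f x ≤ 1) → (∀ x ∉ C, f x = 0) → ∫ x, f x ∂μ ≤ μ.real C := by
    intro C f hC hf h1 h0
    rw [← integral_indicator_one hC]
    refine integral_mono hf ((integrable_const 1).indicator hC) fun x => ?_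
    by_cases hx : x ∈ C
    · simpa [hx] using h1 x
    · simp [hx, h0 x hx]
  have hFG := hF.integrable_mul hG μ
  have hb1 := hlow hB₁ (hF.integrable μ) hF.nonneg hFB
  have hb2 := hlow hB₂ (hG.integrable μ) hG.nonneg hGB
  have hc1 := hup hC₁ (hF.integrable μ) hF.le_one hFC
  have hc2 := hup hC₂ (hG.integrable μ) hG.le_one hGC
  have hb := hlow (hB₁.inter hB₂) hFG (fun x => mul_nonneg (hF.nonneg x) (hG.nonneg x))
    fun x hx => by rw [hFB x hx.1, hGB x hx.2, mul_one]
  have hc := hup (hC₁.inter hC₂) hFG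
    (fun x => mul_le_one₀ (hF.le_one x) (hG.nonneg x) (hG.le_one x)) fun x hx => by
      by_cases h : x ∈ C₁
      · rw [hGC x fun h' => hx ⟨h, h'⟩, mul_zero]
      · rw [hFC x h, zero_mul]
  have hF0 : 0 ≤ ∫ x, F x ∂μ := integral_nonneg hF.nonneg
  have hG0 : 0 ≤ ∫ x, G x ∂μ := integral_nonneg hG.nonneg
  have hcc := mul_le_mul hc1 hc2 hG0 measureReal_nonneg
  have hbb := mul_le_mul hb1 hb2 measureReal_nonneg hF0
  constructor <;> linarith

end IsSoftIndicator

/-! ### The decoupling inequality -/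

/-- The thickened indicator of an increasing set `A` lies between the indicators of `A` and of
`{x | x + ε ∈ A}`. -/
theorem exists_isSoftIndicator {n : ℕ} {A : Set (Fin n → ℝ)} {I : Finset (Fin n)}
    (hinc : IsIncreasing A) (hsupp : IsSupportedOn A I) {ε : ℝ} (hε : 0 < ε) :
    ∃ F, IsSoftIndicator F I ε.toNNReal⁻¹ ∧ (∀ x ∈ A, F x = 1) ∧
      ∀ x, (x + fun _ => ε) ∉ A → F x = 0 := by
  -- the distance to `A` decreases along translations that preserve `A`
  have htrans : ∀ x v : Fin n → ℝ, (∀ y ∈ A, y + v ∈ A) →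
      Metric.infEDist (x + v) A ≤ Metric.infEDist x A := fun x v hv =>
    Metric.le_infEDist.2 fun y hy => by
      simpa using Metric.infEDist_le_edist_of_mem (x := x + v) (hv y hy)
  refine ⟨fun x => thickenedIndicator hε A x, ⟨fun x y hxy => ?_, ?_, fun x v hv => ?_,
    fun x => NNReal.coe_nonneg _, fun x => ?_⟩, fun x hx => ?_, fun x hx => ?_⟩
  · refine NNReal.coe_le_coe.2 (thickenedIndicator_mono_infEDist hε ?_)
    simpa using htrans x (y - x) fun z hz => hinc z _ (sub_nonneg.2 hxy) hz
  · exact .of_dist_le_mul fun x y => (lipschitzWith_thickenedIndicator hε A).dist_le_mul x y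
  · have h1 := htrans x v fun y hy => (hsupp y v hv).1 hy
    have h2 := htrans (x + v) (-v) fun y hy =>
      (hsupp y (-v) fun i hi => by simp [hv i hi]).1 hy
    rw [add_neg_cancel_right] at h2
    exact congrArg _ (le_antisymm (thickenedIndicator_mono_infEDist hε h2)
      (thickenedIndicator_mono_infEDist hε h1))
  · exact_mod_cast thickenedIndicator_le_one hε A x
  · simp [thickenedIndicator_one hε A hx]
  · refine NNReal.coe_eq_zero.2 (thickenedIndicator_zero hε A ?_)
    intro hx'
    obtain ⟨a, ha, hxa⟩ := Metric.mem_thickening_iff.1 hx'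
    apply hx
    have := hinc a (x + (fun _ => ε) - a) (fun i => ?_) ha
    · simpa using this
    · have := (abs_lt.1 ((dist_le_pi_dist x a i).trans_lt hxa)).1
      simp only [Pi.zero_apply, Pi.sub_apply, Pi.add_apply]
      linarith

theorem exists_isSoftIndicator_sub {n : ℕ} {A : Set (Fin n → ℝ)} {I : Finset (Fin n)}
    (hinc : IsIncreasing A) (hsupp : IsSupportedOn A I) {ε : ℝ} (hε : 0 < ε) :
    ∃ F, IsSoftIndicator F I ε.toNNReal⁻¹ ∧ (∀ x, (x - fun _ => ε) ∈ A → F x = 1) ∧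
      ∀ x ∉ A, F x = 0 := by
  obtain ⟨F, hF, h1, h0⟩ := exists_isSoftIndicator hinc hsupp hε
  refine ⟨_, hF.comp_add_right (-fun _ => ε), fun x hx => h1 _ ?_, fun x hx => h0 _ ?_⟩
  · rwa [← sub_eq_add_neg]
  · rwa [neg_add_cancel_right]

theorem theoremt :
    ∃ c : ℝ, 0 < c ∧
      ∀ {Ω : Type*} [MeasurableSpace Ω] (P : Measure Ω) [IsProbabilityMeasure P]
        (n : ℕ) (X : Ω → Fin n → ℝ) (_hX : HasGaussianLaw X P)
        (I₁ I₂ : Finset (Fin n)) (A₁ A₂ : Set (Fin n → ℝ))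
        (_hA₁ : MeasurableSet A₁) (_hA₂ : MeasurableSet A₂)
        (_hinc₁ : IsIncreasing A₁) (_hinc₂ : IsIncreasing A₂)
        (_hsupp₁ : IsSupportedOn A₁ I₁) (_hsupp₂ : IsSupportedOn A₂ I₂)
        (ε : ℝ) (_hε : 0 < ε),
        (P.real {ω | X ω ∈ A₁ ∩ A₂}
            - P.real {ω | (X ω + fun _ => ε) ∈ A₁} * P.real {ω | (X ω + fun _ => ε) ∈ A₂}
          ≤ c * maxAbsEntry (crossCov P X I₁ I₂) / ε ^ 2) ∧
        (P.real {ω | (X ω - fun _ => ε) ∈ A₁} * P.real {ω | (X ω - fun _ => ε) ∈ A₂}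
            - P.real {ω | X ω ∈ A₁ ∩ A₂}
          ≤ c * maxAbsEntry (crossCov P X I₁ I₂) / ε ^ 2) ∧
        ((∀ i j, 0 ≤ crossCov P X I₁ I₂ i j) →
          (P.real {ω | X ω ∈ A₁ ∩ A₂}
              - P.real {ω | (X ω + fun _ => ε) ∈ A₁} * P.real {ω | (X ω + fun _ => ε) ∈ A₂}
            ≤ 1 * maxAbsEntry (crossCov P X I₁ I₂) / ε ^ 2) ∧
          (P.real {ω | (X ω - fun _ => ε) ∈ A₁} * P.real {ω | (X ω - fun _ => ε) ∈ A₂}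
              - P.real {ω | X ω ∈ A₁ ∩ A₂}
            ≤ 0 * maxAbsEntry (crossCov P X I₁ I₂) / ε ^ 2)) := by
  refine ⟨1, one_pos, ?_⟩
  intro Ω _ P _ n X hX I₁ I₂ A₁ A₂ hA₁ hA₂ hinc₁ hinc₂ hsupp₁ hsupp₂ ε hε
  have hG : IsGaussian (P.map X) := hX.isGaussian_map
  have hXm := hX.aemeasurable
  set μ := P.map X
  have hlaw : ∀ {S : Set (Fin n → ℝ)}, MeasurableSet S → P.real {ω | X ω ∈ S} = μ.real S :=
    fun hS => (map_measureReal_apply_of_aemeasurable hXm hS).symm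
  have hcov : ∀ (i : I₁) (j : I₂), cov[fun x => x i, fun x => x j; μ] = crossCov P X I₁ I₂ i j :=
    fun i j => covariance_map_fun (measurable_pi_apply _).aestronglyMeasurable
      (measurable_pi_apply _).aestronglyMeasurable hXm
  set κ := maxAbsEntry (crossCov P X I₁ I₂)
  have hκ0 : 0 ≤ κ := Real.iSup_nonneg fun _ => abs_nonneg _
  have hκ : ∀ i j, |crossCov P X I₁ I₂ i j| ≤ κ := fun i j =>
    le_ciSup (f := fun p : I₁ × I₂ => |crossCov P X I₁ I₂ p.1 p.2|)
      (Set.finite_range _).bddAbove (i, j)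
  have hc : ((ε.toNNReal⁻¹ : ℝ≥0) : ℝ) = ε⁻¹ := by
    rw [NNReal.coe_inv, Real.coe_toNNReal _ hε.le]
  have hscale : ∀ a : ℝ, ε⁻¹ * ε⁻¹ * a = a / ε ^ 2 := fun a => by field_simp
  have hadd : Measurable fun x : Fin n → ℝ => x + fun _ => ε := by fun_prop
  have hsub : Measurable fun x : Fin n → ℝ => x - fun _ => ε := by fun_prop
  obtain ⟨F, hF, hF1, hF0⟩ := exists_isSoftIndicator hinc₁ hsupp₁ hε
  obtain ⟨G, hG, hG1, hG0⟩ := exists_isSoftIndicator hinc₂ hsupp₂ hε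
  obtain ⟨F', hF', hF'1, hF'0⟩ := exists_isSoftIndicator_sub hinc₁ hsupp₁ hε
  obtain ⟨G', hG', hG'1, hG'0⟩ := exists_isSoftIndicator_sub hinc₂ hsupp₂ hε
  have upper : P.real {ω | X ω ∈ A₁ ∩ A₂}
      - P.real {ω | (X ω + fun _ => ε) ∈ A₁} * P.real {ω | (X ω + fun _ => ε) ∈ A₂}
      ≤ 1 * κ / ε ^ 2 := by
    refine (hlaw (hA₁.inter hA₂) ▸ hlaw (hadd hA₁) ▸ hlaw (hadd hA₂) ▸
      (hF.real_sub_le_covariance hG μ hA₁ hA₂ (hadd hA₁) (hadd hA₂) hF1 hG1 hF0 hG0).1).trans ?_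
    have := hF.mul_covariance_le hG μ (s := 1) hκ0 fun i hi j hj => by
      rw [one_mul, hcov ⟨i, hi⟩ ⟨j, hj⟩]
      exact (le_abs_self _).trans (hκ _ _)
    rwa [hc, hscale, one_mul, ← one_mul κ] at this
  have lower : ∀ {b : ℝ}, 0 ≤ b → (∀ i j, -crossCov P X I₁ I₂ i j ≤ b) →
      P.real {ω | (X ω - fun _ => ε) ∈ A₁} * P.real {ω | (X ω - fun _ => ε) ∈ A₂}
      - P.real {ω | X ω ∈ A₁ ∩ A₂} ≤ b / ε ^ 2 := by
    intro b hb0 hb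
    refine (hlaw (hA₁.inter hA₂) ▸ hlaw (hsub hA₁) ▸ hlaw (hsub hA₂) ▸
      (hF'.real_sub_le_covariance hG' μ (hsub hA₁) (hsub hA₂) hA₁ hA₂ hF'1 hG'1 hF'0 hG'0).2).trans ?_
    have := hF'.mul_covariance_le hG' μ (s := -1) hb0 fun i hi j hj => by
      rw [neg_one_mul, hcov ⟨i, hi⟩ ⟨j, hj⟩]
      exact hb _ _
    rwa [hc, hscale, neg_one_mul] at this
  refine ⟨upper, ?_, fun hpos => ⟨upper, ?_⟩⟩
  · rw [one_mul]
    exact lower hκ0 fun i j => (neg_le_abs _).trans (hκ i j)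
  · rw [zero_mul]
    exact lower le_rfl fun i j => neg_nonpos.2 (hpos i j)
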